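/- Let $K$ be a field. A $K$-variety is a separated scheme of finite type over $K$ (not necessarily reduced or irreducible); morphisms are morphisms of $K$-schemes, and $V(K)$ denotes the set of $K$-points of a $K$-variety $V$. The Zariski topology on $V(K)$ is the one induced by the map $V(K)\to V$. An étale image in $V(K)$ is a set of the form $f(X(K))$ with $f\colon X\to V$ an étale morphism of $K$-varieties. (1) For every $K$-variety $V$, the collection of étale images in $V(K)$ contains all Zariski open subsets of $V(K)$ and is closed under finite unions and finite intersections; it is a basis of a topology $\mathscr{E}_V$ on $V(K)$, the étale-open topology, which refines the Zariski topology. (2) The family $(\mathscr{E}_V)_V$ is a system of topologies: for every morphism $f\colon V\to W$ of $K$-varieties, the induced map $V(K)\to W(K)$ is continuous with respect to $\mathscr{E}_V$ and $\mathscr{E}_W$; it is an open embedding if $f$ is an open immersion, and a closed embedding if $f$ is a closed immersion. (3) If $f\colon V\to W$ is an étale morphism of $K$-varieties, then the induced map $V(K)\to W(K)$ is open with respect to $\mathscr{E}_V$ and $\mathscr{E}_W$. (4) For every morphism $f\colon V\to W$ of $K$-varieties, the preimage in $V(K)$ of an étale image in $W(K)$ is an étale image; if $f$ is étale, the image in $W(K)$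 of an étale image in $V(K)$ is an étale image; if $f$ is a closed immersion, every étale image in $V(K)$ is the preimage of an étale image in $W(K)$. -/

import Mathlib

open CategoryTheory AlgebraicGeometry

universe u

namespace EtaleOpen

/-- The property of a `K`-scheme of being separated and of finite type over `K`
(finite type = locally of finite type and quasi-compact). -/
def isVariety (K : Type u) [Field K] : ObjectProperty (Over (Spec (CommRingCat.of K))) :=
  fun X ↦ IsSeparated X.hom ∧ LocallyOfFiniteType X.hom ∧ QuasiCompact X.hom

/-- The category `Var_K` of `K`-varieties: separated schemes of finite type over `K`, not assumed
to be reduced or irreducible, with morphisms of `K`-schemes. -/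
noncomputable abbrev Variety (K : Type u) [Field K] := (isVariety K).FullSubcategory

variable {K : Type u} [Field K]

/-- The underlying morphism of schemes of a morphism of `K`-varieties. -/
noncomputable abbrev toSchemeHom {V W : Variety K} (f : V ⟶ W) : V.obj.left ⟶ W.obj.left :=
  f.hom.left

/-- The set `V(K)` of `K`-points of `V`: morphisms `Spec K ⟶ V` of `K`-schemes. -/
noncomputable def Points (V : Variety K) : Type u :=
  Over.mk (𝟙 (Spec (CommRingCat.of K))) ⟶ V.obj

/-- The map `V(K) → W(K)` induced by a morphism `V ⟶ W`. -/
noncomputable def mapPoints {V W : Variety K} (f : V ⟶ W) : Points V → Points W :=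
  fun x ↦ x ≫ f.hom

/-- The scheme-theoretic point of `V` determined by a `K`-point: the image of the unique point
of `Spec K`. -/
noncomputable def toPoint (V : Variety K) (x : Points V) : V.obj.left :=
  x.left (IsLocalRing.closedPoint K)

/-- The Zariski topology on `V(K)`, induced by the map `V(K) → V`. -/
noncomputable abbrev zariskiTopology (V : Variety K) : TopologicalSpace (Points V) :=
  TopologicalSpace.induced (toPoint V) inferInstance

/-- `U` is an étale image in `V(K)`: it is the image of `X(K) → V(K)` for some étale morphism
`X ⟶ V` of `K`-varieties. -/
def IsEtaleImage (V : Variety K) (U : Set (Points V)) : Prop :=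
  ∃ (X : Variety K) (f : X ⟶ V), Etale (toSchemeHom f) ∧ Set.range (mapPoints f) = U

/-- The étale-open topology on `V(K)`: the topology generated by the étale images in `V(K)`. -/
abbrev etaleOpenTopology (V : Variety K) : TopologicalSpace (Points V) :=
  TopologicalSpace.generateFrom {U | IsEtaleImage V U}

/-- A family of topologies on the sets `V(K)`, one for each `K`-variety `V`, is a system of
topologies if morphisms induce continuous maps, open immersions induce open embeddings, and
closed immersions induce closed embeddings. -/
structure IsSystemOfTopologies (T : ∀ V : Variety K, TopologicalSpace (Points V)) : Prop where
  continuous : ∀ {V W : Variety K} (f : V ⟶ W),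
    @Continuous _ _ (T V) (T W) (mapPoints f)
  isOpenEmbedding : ∀ {V W : Variety K} (f : V ⟶ W), IsOpenImmersion (toSchemeHom f) →
    @Topology.IsOpenEmbedding _ _ (T V) (T W) (mapPoints f)
  isClosedEmbedding : ∀ {V W : Variety K} (f : V ⟶ W), IsClosedImmersion (toSchemeHom f) →
    @Topology.IsClosedEmbedding _ _ (T V) (T W) (mapPoints f)

end EtaleOpen

/-! Étale morphisms are stable under disjoint union, fibre product, base change and composition;
this yields finite unions, finite intersections, preimages, and images under étale maps. Continuity
and openness follow on the basis of étale images, and open immersions are étale monomorphisms. The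
substantial point is that étale images extend along a closed immersion
(`IsEtaleImage.exists_eq_preimage`). Locally an étale algebra over `B ⧸ I` is standard étale, and
its equations lift to `B` (`exists_standardEtalePair_lift`). Quasi-compactness leaves finitely many
local pieces, and the images of their lifts are united. No gluing is needed, because a map from the
one-point scheme `Spec K` lands in a single piece. -/

namespace EtaleOpen

/-! ### Lifting standard étale algebras along surjections -/

section Algebra

open Polynomial TensorProduct

/-- Two standard étale pairs whose universal roots satisfy each other's conditions have isomorphic
standard étale algebras. -/
noncomputable def standardEtaleEquiv {R : Type*} [CommRing R] (P Q : StandardEtalePair R)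
    (h : P.HasMap Q.X) (h' : Q.HasMap P.X) : P.Ring ≃ₐ[R] Q.Ring :=
  .ofAlgHom (P.lift Q.X h) (Q.lift P.X h') (Q.hom_ext (by simp)) (P.hom_ext (by simp))

/-- A standard étale pair over a quotient lifts, up to replacing `g` by a power of itself. -/
lemma exists_standardEtalePair_lift {B A : Type*} [CommRing B] [CommRing A] (φ : B →+* A)
    (hφ : Function.Surjective φ) (Q : StandardEtalePair A) :
    ∃ (P : StandardEtalePair B) (n : ℕ), (P.map φ).f = Q.f ∧ (P.map φ).g = Q.g ^ (n + 1) := by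
  obtain ⟨p₁, p₂, n, e⟩ := Q.cond
  obtain ⟨F, hF, -, hFm⟩ := lifts_and_natDegree_eq_and_monic (f := φ) (p := Q.f)
    (map_surjective φ hφ Q.f) Q.monic_f
  obtain ⟨G, hG⟩ := map_surjective φ hφ Q.g
  obtain ⟨P₁, h₁⟩ := map_surjective φ hφ p₁
  obtain ⟨P₂, h₂⟩ := map_surjective φ hφ p₂
  -- Multiplying `G` by the lift of `f' p₁ + f p₂ = g ^ n` forces the étaleness relation over `B`,
  -- with exponent 1. Keeping the factor `G` makes the reduction `g ^ (n + 1)`, a positive power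
  -- even if `n = 0`.
  refine ⟨⟨F, hFm, G * (derivative F * P₁ + F * P₂), G * P₁, G * P₂, 1, by ring⟩, n, hF, ?_⟩
  simp only [StandardEtalePair.map_g, Polynomial.map_mul, Polynomial.map_add, hG, h₁, h₂, hF,
    ← derivative_map, e]
  ring

/-- Standard étale algebras lift along surjective ring homomorphisms. -/
lemma exists_etale_lift_of_surjective {B A C : Type*} [CommRing B] [CommRing A] [CommRing C]
    [Algebra B A] [Algebra A C] [Algebra.IsStandardEtale A C]
    (h : Function.Surjective (algebraMap B A)) :
    ∃ P : StandardEtalePair B, Nonempty (A ⊗[B] P.Ring ≃ₐ[A] C) := by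
  obtain ⟨Q⟩ := Algebra.IsStandardEtale.nonempty_standardEtalePresentation (R := A) (S := C)
  obtain ⟨P, n, hf, hg⟩ := exists_standardEtalePair_lift (algebraMap B A) h Q.P
  let P₀ : StandardEtalePresentation B P.Ring :=
    ⟨P, P.X, P.hasMap_X, by simpa [StandardEtalePair.lift_X_left] using Function.bijective_id⟩
  -- Inverting a positive power of `g` is the same as inverting `g`, so both pairs over `A` have the
  -- same admissible roots.
  have key {T : Type _} [CommRing T] [Algebra A T] (x : T) :
      (P.map (algebraMap B A)).HasMap x ↔ Q.P.HasMap x := by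
    simp only [StandardEtalePair.HasMap, hf, hg, map_pow]
    rw [isUnit_pow_iff (by simp)]
  exact ⟨P, ⟨(P₀.baseChange (T := A)).equivRing.trans ((standardEtaleEquiv _ Q.P
    ((key _).2 Q.P.hasMap_X) ((key _).1 StandardEtalePair.hasMap_X)).trans Q.equivRing.symm)⟩⟩

end Algebra

/-! ### Coproducts and local extension of étale morphisms -/

section Geometry

open Limits

/-- A property of morphisms that is local at the target holds for a morphism out of a coproduct as
soon as it holds for its components. -/
lemma coprodDesc_of_isZariskiLocalAtTarget (P : MorphismProperty Scheme.{u})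
    [IsZariskiLocalAtTarget P] [P.IsStableUnderComposition] {X Y Z : Scheme.{u}} (f : X ⟶ Z)
    (g : Y ⟶ Z) (hf : P f) (hg : P g) (hZ : P (coprod.desc (𝟙 Z) (𝟙 Z))) :
    P (coprod.desc f g) := by
  have h : coprod.desc f g = coprod.map f g ≫ coprod.desc (𝟙 Z) (𝟙 Z) := by simp
  exact h ▸ P.comp_mem _ _ (IsZariskiLocalAtTarget.coprodMap f g hf hg) hZ

lemma isZariskiLocalAtTarget_of_hasAffineProperty (P : MorphismProperty Scheme.{u})
    {Q : AffineTargetMorphismProperty.{u}} (_ : HasAffineProperty P Q) : IsZariskiLocalAtTarget P :=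
  inferInstance

/-- Such properties are local on the source, so the two summands can be checked separately.
Separatedness and quasi-compactness are not, and go through the fold map instead. -/
lemma coprodDesc_of_hasRingHomProperty (P : MorphismProperty Scheme.{u})
    (Q : ∀ {R S : Type u} [CommRing R] [CommRing S], (R →+* S) → Prop) [HasRingHomProperty P Q]
    {X Y Z : Scheme.{u}} (f : X ⟶ Z) (g : Y ⟶ Z) (hf : P f) (hg : P g) : P (coprod.desc f g) := by
  rw [IsZariskiLocalAtSource.iff_of_openCover (P := P) (coprodOpenCover.{_, 0} X Y)]
  rintro (_ | _)
  · rw [← coprod.inl_desc f g] at hf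
    exact hf
  · rw [← coprod.inr_desc f g] at hg
    exact hg

instance isSeparated_coprodDesc {X Y Z : Scheme.{u}} (f : X ⟶ Z) (g : Y ⟶ Z) [IsSeparated f]
    [IsSeparated g] : IsSeparated (coprod.desc f g) :=
  coprodDesc_of_isZariskiLocalAtTarget _ f g ‹_› ‹_› inferInstance

instance quasiCompact_coprodDesc {X Y Z : Scheme.{u}} (f : X ⟶ Z) (g : Y ⟶ Z) [QuasiCompact f]
    [QuasiCompact g] : QuasiCompact (coprod.desc f g) :=
  have := isZariskiLocalAtTarget_of_hasAffineProperty @QuasiCompact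
    instHasAffinePropertyQuasiCompactCompactSpaceCarrierCarrierCommRingCat
  coprodDesc_of_isZariskiLocalAtTarget @QuasiCompact f g ‹_› ‹_› inferInstance

instance etale_coprodDesc {X Y Z : Scheme.{u}} (f : X ⟶ Z) (g : Y ⟶ Z) [Etale f]
    [Etale g] : Etale (coprod.desc f g) :=
  coprodDesc_of_hasRingHomProperty @Etale RingHom.Etale f g ‹_› ‹_›

/-- An étale algebra over a quotient of `B` is, near each prime, the base change of an
étale `B`-algebra. -/
lemma exists_isPullback_SpecMap {B A C : CommRingCat.{u}} (φ : B ⟶ A)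
    (hφ : Function.Surjective φ) (ψ : A ⟶ C) [Etale (Spec.map ψ)] (x : Spec C) :
    ∃ (U Y : Scheme.{u}) (_ : IsAffine U) (_ : IsAffine Y) (j : U ⟶ Spec C) (v : U ⟶ Y)
      (q : Y ⟶ Spec B), IsOpenImmersion j ∧ Etale q ∧ x ∈ Set.range j ∧
      IsPullback (j ≫ Spec.map ψ) v (Spec.map φ) q := by
  have hψ : ψ.hom.Etale := HasRingHomProperty.Spec_iff.mp ‹Etale (Spec.map ψ)›
  algebraize [ψ.hom, φ.hom]
  have : (PrimeSpectrum.asIdeal x).IsPrime := PrimeSpectrum.isPrime x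
  obtain ⟨g, hg, hstd⟩ := Algebra.IsEtaleAt.exists_isStandardEtale (R := A) (PrimeSpectrum.asIdeal x)
  obtain ⟨P, ⟨e⟩⟩ := exists_etale_lift_of_surjective (B := B) (A := A)
    (C := Localization.Away g) hφ
  refine ⟨Spec (.of (Localization.Away g)), Spec (.of P.Ring), inferInstance, inferInstance,
    Spec.map (CommRingCat.ofHom (algebraMap C (Localization.Away g))),
    Spec.map (CommRingCat.ofHom (e.toRingHom.comp
      (Algebra.TensorProduct.includeRight (R := B) (A := A) (B := P.Ring)).toRingHom)),
    Spec.map (CommRingCat.ofHom (algebraMap B P.Ring)), inferInstance, ?_, ?_, ?_⟩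
  · rw [HasRingHomProperty.Spec_iff (P := @Etale)]
    simpa [RingHom.etale_algebraMap] using (inferInstance : Algebra.Etale B P.Ring)
  · change x ∈ Set.range (PrimeSpectrum.comap (algebraMap C (Localization.Away g)))
    rw [PrimeSpectrum.localization_away_comap_range (Localization.Away g) g]
    exact hg
  · rw [← Spec.map_comp]
    refine isPullback_SpecMap_of_isPushout _ _ _ _ ?_
    refine (CommRingCat.isPushout_tensorProduct B A P.Ring).of_iso (Iso.refl _) (Iso.refl _)
      (Iso.refl _) e.toRingEquiv.toCommRingCatIso ?_ ?_ ?_ ?_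
    · simp; rfl
    · simp
    · ext a
      exact (e.commutes a).trans (IsScalarTower.algebraMap_apply A C (Localization.Away g) a)
    · ext a
      simp

/-- An étale morphism to a closed subscheme of `W` is, locally on the source, the base change of
an étale morphism to `W`. -/
lemma exists_isPullback_of_isClosedImmersion {X V W : Scheme.{u}} (h : X ⟶ V) [Etale h]
    (f : V ⟶ W) [IsClosedImmersion f] (x : X) :
    ∃ (U Y : Scheme.{u}) (_ : IsAffine U) (_ : IsAffine Y) (j : U ⟶ X) (v : U ⟶ Y) (q : Y ⟶ W),
      IsOpenImmersion j ∧ Etale q ∧ IsSeparated q ∧ x ∈ Set.range j ∧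
      IsPullback (j ≫ h) v f q := by
  -- This reduces to affine charts: `Spec B` around the image of `x` in `W`, its trace `Spec (B ⧸
  -- I)` on `V`, and `Spec C` around `x` in the part of `X` above that trace.
  obtain ⟨B, i, hi, w, hw⟩ := W.exists_Spec_apply_eq (f (h x))
  obtain ⟨I, e, he⟩ := IsClosedImmersion.Spec_iff.mp
    (inferInstance : IsClosedImmersion (pullback.snd f i))
  let φ : B ⟶ .of (B ⧸ I) := CommRingCat.ofHom (Ideal.Quotient.mk I)
  let k : Spec (.of (B ⧸ I)) ⟶ V := e.inv ≫ pullback.fst f i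
  have hk : IsPullback k (Spec.map φ) f i :=
    (IsPullback.of_hasPullback f i).of_iso e (Iso.refl _) (Iso.refl _) (Iso.refl _)
      (by simp [k]) (by simp [he, φ]) (by simp) (by simp)
  have : IsOpenImmersion k := by dsimp [k]; infer_instance
  obtain ⟨a, ha⟩ : h x ∈ Set.range k := by
    obtain ⟨z, hz, -⟩ := Scheme.Pullback.exists_preimage_pullback (f := f) (g := i) (h x) w hw.symm
    exact ⟨e.hom z, by simp [k, ← Scheme.Hom.comp_apply, hz]⟩
  obtain ⟨b, hb, hb'⟩ := Scheme.Pullback.exists_preimage_pullback (f := h) (g := k) x a ha.symm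
  obtain ⟨C, l, hl, c, hc⟩ := (pullback h k).exists_Spec_apply_eq b
  obtain ⟨ψ, hψ⟩ := Spec.map_surjective (l ≫ pullback.snd h k)
  have : Etale (Spec.map ψ) := by rw [hψ]; infer_instance
  obtain ⟨U, Y, hU, hY, j, v, q, hj, hq, ⟨u, hu⟩, hp⟩ :=
    exists_isPullback_SpecMap φ Ideal.Quotient.mk_surjective ψ c
  refine ⟨U, Y, hU, hY, j ≫ l ≫ pullback.fst h k, v, q ≫ i, inferInstance, inferInstance,
    inferInstance, ⟨u, ?_⟩, ?_⟩
  · simp only [Scheme.Hom.comp_apply, hu]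
    rw [← hb, ← hc]
  · have h₁ : ((j ≫ Spec.map ψ) ≫ k) = (j ≫ l ≫ pullback.fst h k) ≫ h := by
      simp [hψ, pullback.condition]
    exact h₁ ▸ hp.paste_horiz hk

end Geometry

variable {K : Type u} [Field K]

/-! ### Étale images and the étale-open topology -/

section Points

open Limits
open scoped Topology

instance isSeparated_hom (V : Variety K) : IsSeparated V.obj.hom := V.property.1

instance locallyOfFiniteType_hom (V : Variety K) : LocallyOfFiniteType V.obj.hom := V.property.2.1

instance quasiCompact_hom (V : Variety K) : QuasiCompact V.obj.hom := V.property.2.2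

/-- Open immersions into a locally Noetherian scheme are quasi-compact, so every Zariski open
subscheme can serve as the source of an étale image. -/
instance isLocallyNoetherian_left (V : Variety K) : IsLocallyNoetherian V.obj.left :=
  LocallyOfFiniteType.isLocallyNoetherian V.obj.hom

instance compactSpace_left (V : Variety K) : CompactSpace V.obj.left :=
  QuasiCompact.compactSpace_of_compactSpace V.obj.hom

lemma toSchemeHom_w {V W : Variety K} (f : V ⟶ W) :
    toSchemeHom f ≫ W.obj.hom = V.obj.hom :=
  Over.w f.hom

instance isSeparated_toSchemeHom {V W : Variety K} (f : V ⟶ W) : IsSeparated (toSchemeHom f) :=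
  have : IsSeparated (toSchemeHom f ≫ W.obj.hom) := by rw [toSchemeHom_w]; infer_instance
  IsSeparated.of_comp _ W.obj.hom

instance quasiCompact_toSchemeHom {V W : Variety K} (f : V ⟶ W) : QuasiCompact (toSchemeHom f) :=
  have : QuasiCompact (toSchemeHom f ≫ W.obj.hom) := by rw [toSchemeHom_w]; infer_instance
  QuasiCompact.of_comp _ W.obj.hom

lemma points_ext {V : Variety K} {x y : Points V} (h : x.left = y.left) : x = y :=
  Over.OverMorphism.ext h

@[simp]
lemma mapPoints_left {V W : Variety K} (f : V ⟶ W) (x : Points V) :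
    (mapPoints f x).left = x.left ≫ toSchemeHom f := rfl

lemma points_left_w {V : Variety K} (x : Points V) : x.left ≫ V.obj.hom = 𝟙 (Spec (.of K)) :=
  Over.w x

/-- A morphism `Spec K ⟶ V` of schemes over `K`, as a `K`-point of `V`. -/
noncomputable def pointsMk {V : Variety K} (x : Spec (.of K) ⟶ V.obj.left)
    (h : x ≫ V.obj.hom = 𝟙 (Spec (.of K))) : Points V :=
  Over.homMk x h

/-- `Spec K` has one point; this is what lets a `K`-point factor through an open piece of a cover.
-/
lemma range_spec_field_subset_iff {X : Scheme.{u}} (x : Spec (.of K) ⟶ X) (S : Set X) :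
    Set.range x ⊆ S ↔ x (IsLocalRing.closedPoint K) ∈ S := by
  rw [Set.range_subset_iff]
  exact ⟨fun h ↦ h _, fun h y ↦ (Subsingleton.elim (α := PrimeSpectrum K) y _) ▸ h⟩

/-- The `K`-points of `V` that lift along a morphism of schemes `X ⟶ V`. -/
def liftablePoints (V : Variety K) {X : Scheme.{u}} (f : X ⟶ V.obj.left) : Set (Points V) :=
  {x | ∃ y : Spec (.of K) ⟶ X, y ≫ f = x.left}

/-- A lift of a `K`-point is automatically a morphism over `K`, so étale images can be studied
through bare schemes over `V`. -/
lemma range_mapPoints {V W : Variety K} (f : V ⟶ W) :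
    Set.range (mapPoints f) = liftablePoints W (toSchemeHom f) := by
  ext x
  constructor
  · rintro ⟨y, rfl⟩
    exact ⟨y.left, rfl⟩
  · rintro ⟨y, hy⟩
    refine ⟨pointsMk y ?_, points_ext hy⟩
    rw [← toSchemeHom_w f, reassoc_of% hy, points_left_w]

lemma isEtaleImage_liftablePoints (V : Variety K) {X : Scheme.{u}} (f : X ⟶ V.obj.left)
    [Etale f] [IsSeparated f] [QuasiCompact f] : IsEtaleImage V (liftablePoints V f) := by
  let X' : Variety K := ⟨Over.mk (f ≫ V.obj.hom), by
    refine ⟨?_, ?_, ?_⟩ <;> dsimp <;> infer_instance⟩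
  let f' : X' ⟶ V := ObjectProperty.homMk (Over.homMk f rfl)
  exact ⟨X', f', ‹_›, range_mapPoints f'⟩

lemma isEtaleImage_iff (V : Variety K) (U : Set (Points V)) :
    IsEtaleImage V U ↔ ∃ (X : Scheme.{u}) (f : X ⟶ V.obj.left),
      Etale f ∧ IsSeparated f ∧ QuasiCompact f ∧ liftablePoints V f = U := by
  constructor
  · rintro ⟨X, f, hf, rfl⟩
    exact ⟨_, toSchemeHom f, hf, inferInstance, inferInstance, (range_mapPoints f).symm⟩
  · rintro ⟨X, f, _, _, _, rfl⟩
    exact isEtaleImage_liftablePoints V f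

lemma liftablePoints_of_isOpenImmersion (V : Variety K) {X : Scheme.{u}} (f : X ⟶ V.obj.left)
    [IsOpenImmersion f] : liftablePoints V f = toPoint V ⁻¹' Set.range f := by
  ext x
  constructor
  · rintro ⟨y, hy⟩
    exact ⟨y (IsLocalRing.closedPoint K), by rw [toPoint, ← hy]; rfl⟩
  · intro hx
    have h := (range_spec_field_subset_iff x.left (Set.range f)).2 hx
    exact ⟨IsOpenImmersion.lift f x.left h, IsOpenImmersion.lift_fac f x.left h⟩

lemma isEtaleImage_of_isOpen_zariskiTopology {V : Variety K} {U : Set (Points V)}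
    (hU : IsOpen[zariskiTopology V] U) : IsEtaleImage V U := by
  obtain ⟨O, hO, rfl⟩ := isOpen_induced_iff.1 hU
  let O' : V.obj.left.Opens := ⟨O, hO⟩
  have h : liftablePoints V O'.ι = toPoint V ⁻¹' O := by
    rw [liftablePoints_of_isOpenImmersion, Scheme.Opens.range_ι]; rfl
  exact h ▸ isEtaleImage_liftablePoints V O'.ι

lemma liftablePoints_coprodDesc (V : Variety K) {X Y : Scheme.{u}} (f : X ⟶ V.obj.left)
    (g : Y ⟶ V.obj.left) :
    liftablePoints V (coprod.desc f g) = liftablePoints V f ∪ liftablePoints V g := by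
  ext x
  constructor
  · rintro ⟨y, hy⟩
    have h := (isCompl_range_inl_inr X Y).sup_eq_top.ge
      (Set.mem_univ (y (IsLocalRing.closedPoint K)))
    rcases h with h | h <;> rw [← range_spec_field_subset_iff] at h
    · exact .inl ⟨IsOpenImmersion.lift _ y h, (congrArg (_ ≫ ·) (coprod.inl_desc f g)).symm.trans
        ((IsOpenImmersion.lift_fac_assoc _ y h _).trans hy)⟩
    · exact .inr ⟨IsOpenImmersion.lift _ y h, (congrArg (_ ≫ ·) (coprod.inr_desc f g)).symm.trans
        ((IsOpenImmersion.lift_fac_assoc _ y h _).trans hy)⟩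
  · rintro (⟨y, hy⟩ | ⟨y, hy⟩)
    · exact ⟨y ≫ coprod.inl,
        (Category.assoc _ _ _).trans ((congrArg (y ≫ ·) (coprod.inl_desc f g)).trans hy)⟩
    · exact ⟨y ≫ coprod.inr,
        (Category.assoc _ _ _).trans ((congrArg (y ≫ ·) (coprod.inr_desc f g)).trans hy)⟩

lemma liftablePoints_pullback (V : Variety K) {X Y : Scheme.{u}} (f : X ⟶ V.obj.left)
    (g : Y ⟶ V.obj.left) :
    liftablePoints V (pullback.fst f g ≫ f) = liftablePoints V f ∩ liftablePoints V g := by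
  ext x
  constructor
  · rintro ⟨y, hy⟩
    exact ⟨⟨y ≫ pullback.fst f g, by simpa using hy⟩,
      ⟨y ≫ pullback.snd f g, by simpa [pullback.condition] using hy⟩⟩
  · rintro ⟨⟨y, hy⟩, ⟨z, hz⟩⟩
    exact ⟨pullback.lift y z (hy.trans hz.symm), (pullback.lift_fst_assoc _ _ _ _).trans hy⟩

/-- The points of `V` lifting along a base change are those whose image lifts. -/
lemma liftablePoints_of_isPullback {V W : Variety K} (f : V ⟶ W) {P Y : Scheme.{u}}
    {p : P ⟶ V.obj.left} {v : P ⟶ Y} {q : Y ⟶ W.obj.left} (h : IsPullback p v (toSchemeHom f) q) :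
    liftablePoints V p = mapPoints f ⁻¹' liftablePoints W q := by
  ext x
  constructor
  · rintro ⟨y, hy⟩
    exact ⟨y ≫ v, by rw [Category.assoc, ← h.w, reassoc_of% hy, mapPoints_left]⟩
  · rintro ⟨y, hy⟩
    exact ⟨h.lift x.left y hy.symm, h.lift_fst _ _ _⟩

lemma IsEtaleImage.union {V : Variety K} {U U' : Set (Points V)} (h : IsEtaleImage V U)
    (h' : IsEtaleImage V U') : IsEtaleImage V (U ∪ U') := by
  obtain ⟨X, f, _, _, _, rfl⟩ := (isEtaleImage_iff V U).1 h
  obtain ⟨Y, g, _, _, _, rfl⟩ := (isEtaleImage_iff V U').1 h'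
  exact liftablePoints_coprodDesc V f g ▸ isEtaleImage_liftablePoints V _

lemma IsEtaleImage.inter {V : Variety K} {U U' : Set (Points V)} (h : IsEtaleImage V U)
    (h' : IsEtaleImage V U') : IsEtaleImage V (U ∩ U') := by
  obtain ⟨X, f, _, _, _, rfl⟩ := (isEtaleImage_iff V U).1 h
  obtain ⟨Y, g, _, _, _, rfl⟩ := (isEtaleImage_iff V U').1 h'
  exact liftablePoints_pullback V f g ▸ isEtaleImage_liftablePoints V _

lemma isEtaleImage_empty (V : Variety K) : IsEtaleImage V ∅ :=
  isEtaleImage_of_isOpen_zariskiTopology (@isOpen_empty _ (zariskiTopology V))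

lemma isEtaleImage_univ (V : Variety K) : IsEtaleImage V Set.univ :=
  isEtaleImage_of_isOpen_zariskiTopology (@isOpen_univ _ (zariskiTopology V))

lemma isEtaleImage_sUnion {V : Variety K} {S : Set (Set (Points V))} (hS : S.Finite)
    (h : ∀ U ∈ S, IsEtaleImage V U) : IsEtaleImage V (⋃₀ S) := by
  induction S, hS using Set.Finite.induction_on with
  | empty => simpa using isEtaleImage_empty V
  | insert _ _ ih =>
    rw [Set.sUnion_insert]
    exact (h _ (Set.mem_insert _ _)).union (ih fun U hU ↦ h U (Set.mem_insert_of_mem _ hU))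

lemma isEtaleImage_sInter {V : Variety K} {S : Set (Set (Points V))} (hS : S.Finite)
    (h : ∀ U ∈ S, IsEtaleImage V U) : IsEtaleImage V (⋂₀ S) := by
  induction S, hS using Set.Finite.induction_on with
  | empty => simpa using isEtaleImage_univ V
  | insert _ _ ih =>
    rw [Set.sInter_insert]
    exact (h _ (Set.mem_insert _ _)).inter (ih fun U hU ↦ h U (Set.mem_insert_of_mem _ hU))

lemma IsEtaleImage.preimage {V W : Variety K} (f : V ⟶ W) {U : Set (Points W)}
    (h : IsEtaleImage W U) : IsEtaleImage V (mapPoints f ⁻¹' U) := by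
  obtain ⟨X, g, _, _, _, rfl⟩ := (isEtaleImage_iff W U).1 h
  exact liftablePoints_of_isPullback f (IsPullback.of_hasPullback (toSchemeHom f) g) ▸
    isEtaleImage_liftablePoints V _

lemma mapPoints_comp {V W Z : Variety K} (f : V ⟶ W) (g : W ⟶ Z) :
    mapPoints (f ≫ g) = mapPoints g ∘ mapPoints f := by
  ext1 x
  exact points_ext (Category.assoc _ _ _).symm

lemma IsEtaleImage.image {V W : Variety K} (f : V ⟶ W) (hf : Etale (toSchemeHom f))
    {U : Set (Points V)} (h : IsEtaleImage V U) : IsEtaleImage W (mapPoints f '' U) := by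
  obtain ⟨X, g, _, rfl⟩ := h
  refine ⟨X, g ≫ f, ?_, by rw [mapPoints_comp, Set.range_comp]⟩
  change Etale (toSchemeHom g ≫ toSchemeHom f)
  infer_instance

/-- Étale images in a closed subvariety extend to étale images in the ambient variety. -/
lemma IsEtaleImage.exists_eq_preimage {V W : Variety K} (f : V ⟶ W)
    [IsClosedImmersion (toSchemeHom f)] {U : Set (Points V)} (h : IsEtaleImage V U) :
    ∃ U', IsEtaleImage W U' ∧ U = mapPoints f ⁻¹' U' := by
  obtain ⟨X, h, hh, rfl⟩ := h
  rw [range_mapPoints]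
  choose T Y hT hY j v q hj hq hs hx hp using
    exists_isPullback_of_isClosedImmersion (toSchemeHom h) (toSchemeHom f)
  -- `X` is quasi-compact, so finitely many pieces suffice and the union of their images is again an
  -- étale image.
  obtain ⟨t, ht⟩ := isCompact_univ.elim_finite_subcover (fun x ↦ Set.range (j x))
    (fun x ↦ (j x).isOpenEmbedding.isOpen_range) (fun x _ ↦ Set.mem_iUnion.2 ⟨x, hx x⟩)
  refine ⟨⋃₀ ((fun x ↦ liftablePoints W (q x)) '' t),
    isEtaleImage_sUnion (t.finite_toSet.image _) ?_, ?_⟩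
  · rintro _ ⟨x, -, rfl⟩
    exact isEtaleImage_liftablePoints W (q x)
  · rw [Set.sUnion_image, Set.preimage_iUnion₂]
    simp_rw [← fun x ↦ liftablePoints_of_isPullback f (hp x)]
    ext x
    simp only [Set.mem_iUnion]
    constructor
    · rintro ⟨y, hy⟩
      obtain ⟨i, hi, hyi⟩ := Set.mem_iUnion₂.1 (ht (Set.mem_univ (y (IsLocalRing.closedPoint K))))
      have hr := (range_spec_field_subset_iff y _).2 hyi
      exact ⟨i, hi, IsOpenImmersion.lift (j i) y hr, by
        rw [IsOpenImmersion.lift_fac_assoc, hy]⟩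
    · rintro ⟨i, -, y, hy⟩
      exact ⟨y ≫ j i, by simpa using hy⟩

lemma isTopologicalBasis_isEtaleImage (V : Variety K) :
    @TopologicalSpace.IsTopologicalBasis _ (etaleOpenTopology V) {U | IsEtaleImage V U} :=
  @TopologicalSpace.IsTopologicalBasis.mk _ (etaleOpenTopology V) _
    (fun U hU U' hU' _ hx ↦ ⟨U ∩ U', hU.inter hU', hx, subset_rfl⟩)
    (Set.eq_univ_of_univ_subset (Set.subset_sUnion_of_mem (isEtaleImage_univ V))) rfl

lemma IsEtaleImage.isOpen {V : Variety K} {U : Set (Points V)} (h : IsEtaleImage V U) :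
    IsOpen[etaleOpenTopology V] U :=
  TopologicalSpace.isOpen_generateFrom_of_mem h

lemma continuous_mapPoints {V W : Variety K} (f : V ⟶ W) :
    @Continuous _ _ (etaleOpenTopology V) (etaleOpenTopology W) (mapPoints f) :=
  (@continuous_generateFrom_iff _ _ (mapPoints f) (etaleOpenTopology V) _).2
    fun _ hU ↦ (IsEtaleImage.preimage f hU).isOpen

lemma isOpenMap_mapPoints {V W : Variety K} (f : V ⟶ W) (hf : Etale (toSchemeHom f)) :
    @IsOpenMap _ _ (etaleOpenTopology V) (etaleOpenTopology W) (mapPoints f) :=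
  let := etaleOpenTopology V
  let := etaleOpenTopology W
  (isTopologicalBasis_isEtaleImage V).isOpenMap_iff.2 fun _ hU ↦ (hU.image f hf).isOpen

lemma mapPoints_injective {V W : Variety K} (f : V ⟶ W) [Mono (toSchemeHom f)] :
    Function.Injective (mapPoints f) := fun x y h ↦ by
  have h' := congrArg (fun z : Points W ↦ z.left) h
  exact points_ext ((cancel_mono (toSchemeHom f)).1 h')

/-- If the point lies in the image of `V`, then `V ×_W Spec K` is a nonempty closed subscheme of the
reduced one-point scheme `Spec K`, hence all of it. Inverting the projection gives the lift. -/
lemma range_mapPoints_of_isClosedImmersion {V W : Variety K} (f : V ⟶ W)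
    [IsClosedImmersion (toSchemeHom f)] :
    Set.range (mapPoints f) = toPoint W ⁻¹' Set.range (toSchemeHom f) := by
  rw [range_mapPoints]
  ext x
  constructor
  · rintro ⟨y, hy⟩
    exact ⟨y (IsLocalRing.closedPoint K), by rw [toPoint, ← hy]; rfl⟩
  · rintro ⟨z, hz⟩
    have : Surjective (pullback.snd (toSchemeHom f) x.left) := by
      refine ⟨fun y ↦ ?_⟩
      obtain rfl : y = IsLocalRing.closedPoint K := Subsingleton.elim (α := PrimeSpectrum K) _ _
      obtain ⟨w, -, hw⟩ := Scheme.Pullback.exists_preimage_pullback z _ hz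
      exact ⟨w, hw⟩
    have : IsReduced (Over.mk (𝟙 (Spec (.of K)))).left :=
      inferInstanceAs (IsReduced (Spec (.of K)))
    have := isIso_of_isClosedImmersion_of_surjective (pullback.snd (toSchemeHom f) x.left)
    exact ⟨inv (pullback.snd (toSchemeHom f) x.left) ≫ pullback.fst _ _, by
      simp [pullback.condition]⟩

lemma isSystemOfTopologies_etaleOpenTopology :
    IsSystemOfTopologies (fun V : Variety K ↦ etaleOpenTopology V) where
  continuous := continuous_mapPoints
  isOpenEmbedding {V W} f _ :=
    let := etaleOpenTopology V
    let := etaleOpenTopology W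
    .of_continuous_injective_isOpenMap (continuous_mapPoints f) (mapPoints_injective f)
      (isOpenMap_mapPoints f inferInstance)
  isClosedEmbedding {V W} f _ := by
    let := etaleOpenTopology V
    let := etaleOpenTopology W
    refine ⟨⟨⟨?_⟩, mapPoints_injective f⟩, ?_⟩
    -- Extending étale images to `W` shows that the induced topology is no coarser than the
    -- étale-open topology of `V`.
    · refine le_antisymm (continuous_mapPoints f).le_induced (le_generateFrom fun U hU ↦ ?_)
      obtain ⟨U', hU', rfl⟩ := IsEtaleImage.exists_eq_preimage f hU
      exact ⟨U', hU'.isOpen, rfl⟩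
    · rw [range_mapPoints_of_isClosedImmersion, ← isOpen_compl_iff]
      refine (isEtaleImage_of_isOpen_zariskiTopology ?_).isOpen
      exact isOpen_induced_iff.2
        ⟨_, (toSchemeHom f).isClosedEmbedding.isClosed_range.isOpen_compl, rfl⟩

end Points

end EtaleOpen

theorem theoremA (K : Type u) [Field K] :
    -- étale images: all Zariski open sets, closed under finite unions and intersections, a basis
    (∀ V : EtaleOpen.Variety K,
      (∀ U : Set (EtaleOpen.Points V),
        @IsOpen _ (EtaleOpen.zariskiTopology V) U → EtaleOpen.IsEtaleImage V U) ∧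
      (∀ S : Set (Set (EtaleOpen.Points V)), S.Finite →
        (∀ U ∈ S, EtaleOpen.IsEtaleImage V U) →
          EtaleOpen.IsEtaleImage V (⋃₀ S) ∧ EtaleOpen.IsEtaleImage V (⋂₀ S)) ∧
      @TopologicalSpace.IsTopologicalBasis _ (EtaleOpen.etaleOpenTopology V)
        {U | EtaleOpen.IsEtaleImage V U} ∧
      (∀ U : Set (EtaleOpen.Points V), @IsOpen _ (EtaleOpen.zariskiTopology V) U →
        @IsOpen _ (EtaleOpen.etaleOpenTopology V) U)) ∧
    -- the étale-open topologies form a system of topologies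
    EtaleOpen.IsSystemOfTopologies (fun V : EtaleOpen.Variety K ↦ EtaleOpen.etaleOpenTopology V) ∧
    -- étale morphisms induce open maps
    (∀ (V W : EtaleOpen.Variety K) (f : V ⟶ W), Etale (EtaleOpen.toSchemeHom f) →
      @IsOpenMap _ _ (EtaleOpen.etaleOpenTopology V) (EtaleOpen.etaleOpenTopology W)
        (EtaleOpen.mapPoints f)) ∧
    -- preimages of étale images are étale images
    (∀ (V W : EtaleOpen.Variety K) (f : V ⟶ W) (U : Set (EtaleOpen.Points W)),
      EtaleOpen.IsEtaleImage W U → EtaleOpen.IsEtaleImage V (EtaleOpen.mapPoints f ⁻¹' U)) ∧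
    -- images of étale images under étale morphisms are étale images
    (∀ (V W : EtaleOpen.Variety K) (f : V ⟶ W), Etale (EtaleOpen.toSchemeHom f) →
      ∀ U : Set (EtaleOpen.Points V),
        EtaleOpen.IsEtaleImage V U → EtaleOpen.IsEtaleImage W (EtaleOpen.mapPoints f '' U)) ∧
    -- for closed immersions, étale images are restrictions of étale images
    (∀ (V W : EtaleOpen.Variety K) (f : V ⟶ W), IsClosedImmersion (EtaleOpen.toSchemeHom f) →
      ∀ U : Set (EtaleOpen.Points V), EtaleOpen.IsEtaleImage V U →
        ∃ U' : Set (EtaleOpen.Points W),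
          EtaleOpen.IsEtaleImage W U' ∧ U = EtaleOpen.mapPoints f ⁻¹' U') := by
  exact ⟨fun V ↦ ⟨fun U hU ↦ EtaleOpen.isEtaleImage_of_isOpen_zariskiTopology hU,
      fun S hS h ↦ ⟨EtaleOpen.isEtaleImage_sUnion hS h, EtaleOpen.isEtaleImage_sInter hS h⟩,
      EtaleOpen.isTopologicalBasis_isEtaleImage V,
      fun U hU ↦ (EtaleOpen.isEtaleImage_of_isOpen_zariskiTopology hU).isOpen⟩,
    EtaleOpen.isSystemOfTopologies_etaleOpenTopology,
    fun V W f hf ↦ EtaleOpen.isOpenMap_mapPoints f hf,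
    fun V W f U hU ↦ hU.preimage f,
    fun V W f hf U hU ↦ hU.image f hf,
    fun V W f _ U hU ↦ EtaleOpen.IsEtaleImage.exists_eq_preimage f hU⟩
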